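/- **Theorem (Uniqueness).** Let $n\ge 1$ and let $\Omega\subset\mathbb{R}^n$ be a bounded domain (open, connected, nonempty) with piecewise smooth boundary: outside a set of vanishing $(n-1)$-dimensional Hausdorff measure, $\partial\Omega$ is locally a $C^1$ hypersurface with $\Omega$ on one side; $\widehat{\mathbf n}$ denotes the unit outward normal at such points. Let $\mu>0$, $\beta>0$ and $\gamma$ be real constants and $\mathbf b:\Omega\to\mathbb{R}^n$ a given field. For $i=1,2$ let $\phi_i>0$ be a porosity on $\overline\Omega$, let $\mathbf K_i(\mathbf x)$, $\mathbf x\in\Omega$, be positive definite (not necessarily symmetric) tensors, put $\rho_i=\phi_i\gamma$, let $\partial\Omega=\Gamma_i^v\cup\Gamma_i^p$ with $\Gamma_i^v\cap\Gamma_i^p=\emptyset$, and let $v_{ni}$ on $\Gamma_i^v$ and $p_{0i}$ on $\Gamma_i^p$ be given functions. A classical solution of the steady double porosity/permeability model is a tuple $(\mathbf v_1,\mathbf v_2,p_1,p_2,\chi)$ such that $p_i$ and $\phi_i\mathbf v_i$ belong to $C^1(\Omega)\cap C(\overline\Omega)$ for $i=1,2$ and $$\mu\phi_i^2\mathbf K_i^{-1}\mathbf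 v_i+\phi_i\,\mathrm{grad}[p_i]=\rho_i\mathbf b\ \text{ in }\Omega\quad(i=1,2),$$ $$\mathrm{div}[\phi_1\mathbf v_1]=+\chi,\qquad \mathrm{div}[\phi_2\mathbf v_2]=-\chi,\qquad \chi=-\frac{\beta}{\mu}(p_1-p_2)\ \text{ in }\Omega,$$ $$\mathbf v_i\cdot\widehat{\mathbf n}=v_{ni}\ \text{ on }\Gamma_i^v\text{ wherever }\widehat{\mathbf n}\text{ is defined},\qquad p_i=p_{0i}\ \text{ on }\Gamma_i^p\quad(i=1,2).$$ Let $(\mathbf v_1,\mathbf v_2,p_1,p_2,\chi)$ and $(\mathbf v_1',\mathbf v_2',p_1',p_2',\chi')$ be two classical solutions for the same data. Then $\mathbf v_1=\mathbf v_1'$ and $\mathbf v_2=\mathbf v_2'$ on $\overline\Omega$, $\chi=\chi'$ in $\Omega$, and there is one constant $c\in\mathbb{R}$ with $p_1=p_1'+c$ and $p_2=p_2'+c$ on $\overline\Omega$. If moreover $\Gamma_1^p\cup\Gamma_2^p\neq\emptyset$, then also $p_1=p_1'$ and $p_2=p_2'$ on $\overline\Omega$. -/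

import Mathlib

open Set Filter Topology MeasureTheory

noncomputable section

namespace DoublePorosity

/-- The space `ℝⁿ` with its Euclidean norm and inner product. -/
abbrev Space (n : ℕ) := EuclideanSpace ℝ (Fin n)

/-- The divergence `∑ⱼ ∂ⱼ Fⱼ` of a vector field. -/
def divergence {n : ℕ} (F : Space n → Space n) (x : Space n) : ℝ :=
  ∑ j : Fin n, (fderiv ℝ F x (EuclideanSpace.single j 1)) j

/-- `ν` is the unit outward normal to `Ω` at the boundary point `x`: near `x`, the set `Ω` is
the sublevel set `{g < 0}` of a `C¹` function `g` with `∇g(x) ≠ 0` (so that `∂Ω` is a `C¹`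
hypersurface near `x` with `Ω` on one side), and `ν = ∇g(x) / ‖∇g(x)‖`. -/
def IsOutwardUnitNormal {n : ℕ} (Ω : Set (Space n)) (x ν : Space n) : Prop :=
  x ∈ frontier Ω ∧
    ∃ g : Space n → ℝ, ContDiffAt ℝ 1 g x ∧ gradient g x ≠ 0 ∧
      (∀ᶠ y in 𝓝 x, (y ∈ Ω ↔ g y < 0)) ∧ ν = ‖gradient g x‖⁻¹ • gradient g x

/-- The boundary of `Ω` is piecewise smooth: apart from a set of vanishing `(n-1)`-dimensional
Hausdorff measure (edges, corners), it is locally a `C¹` hypersurface with `Ω` on one side.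
The exceptional set is automatically closed. -/
def HasPiecewiseSmoothBoundary {n : ℕ} (Ω : Set (Space n)) : Prop :=
  μH[(n : ℝ) - 1] {x ∈ frontier Ω | ¬ ∃ ν, IsOutwardUnitNormal Ω x ν} = 0

/-- A (not necessarily symmetric) positive definite second-order tensor. -/
def IsPositiveDefinite {n : ℕ} (A : Matrix (Fin n) (Fin n) ℝ) : Prop :=
  ∀ ξ : Space n, ξ ≠ 0 → 0 < inner ℝ (Matrix.toEuclideanLin A ξ) ξ

/-- The parameters and prescribed boundary data of one pore-network: porosity `φ`, permeability
`K`, the boundary parts `Γv`, `Γp` with the prescribed normal velocity `vn` and pressure `p₀`. -/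
structure Network (n : ℕ) where
  φ : Space n → ℝ
  K : Space n → Matrix (Fin n) (Fin n) ℝ
  Γv : Set (Space n)
  Γp : Set (Space n)
  vn : Space n → ℝ
  p₀ : Space n → ℝ

/-- The standing assumptions on one pore-network: positive porosity, positive definite
permeability, and a decomposition of the boundary into two disjoint parts. -/
structure Network.IsAdmissible {n : ℕ} (N : Network n) (Ω : Set (Space n)) : Prop where
  porosity_pos : ∀ x ∈ closure Ω, 0 < N.φ x
  permeability_pos : ∀ x ∈ Ω, IsPositiveDefinite (N.K x)
  boundary_union : N.Γv ∪ N.Γp = frontier Ω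
  boundary_disjoint : Disjoint N.Γv N.Γp

/-- The field `u = φ v` (discharge velocity) of a network. -/
def Network.discharge {n : ℕ} (N : Network n) (v : Space n → Space n) : Space n → Space n :=
  fun x => N.φ x • v x

/-- `(v, p)` solves, in the classical sense, the equations of one pore-network with viscosity
`μ`, true density `γ`, specific body force `b` and volumetric source `s`. -/
structure Network.IsClassicalFlow {n : ℕ} (N : Network n) (Ω : Set (Space n)) (μ γ : ℝ)
    (b : Space n → Space n) (s : Space n → ℝ) (v : Space n → Space n) (p : Space n → ℝ) :
    Prop where
  pressure_contDiff : ContDiffOn ℝ 1 p Ω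
  pressure_continuous : ContinuousOn p (closure Ω)
  discharge_contDiff : ContDiffOn ℝ 1 (N.discharge v) Ω
  discharge_continuous : ContinuousOn (N.discharge v) (closure Ω)
  /-- `μ φ² K⁻¹ v + φ grad p = ρ b` with the bulk density `ρ = φ γ` -/
  momentum : ∀ x ∈ Ω,
    (μ * N.φ x ^ 2) • Matrix.toEuclideanLin (N.K x)⁻¹ (v x) + N.φ x • gradient p x =
      (N.φ x * γ) • b x
  /-- `div (φ v) = s` -/
  mass_balance : ∀ x ∈ Ω, divergence (N.discharge v) x = s x
  /-- `v ⬝ n̂ = vn` on `Γv`, wherever the normal is defined -/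
  velocity_bc : ∀ x ∈ N.Γv, ∀ ν, IsOutwardUnitNormal Ω x ν → inner ℝ (v x) ν = N.vn x
  pressure_bc : ∀ x ∈ N.Γp, p x = N.p₀ x

/-- `(v₁, v₂, p₁, p₂, χ)` is a classical solution of the steady double porosity/permeability
model with macro-pore network `N₁` and micro-pore network `N₂`. -/
structure IsClassicalSolution {n : ℕ} (Ω : Set (Space n)) (N₁ N₂ : Network n) (μ β γ : ℝ)
    (b : Space n → Space n) (v₁ v₂ : Space n → Space n) (p₁ p₂ χ : Space n → ℝ) : Prop where
  flow₁ : N₁.IsClassicalFlow Ω μ γ b (fun x => χ x) v₁ p₁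
  flow₂ : N₂.IsClassicalFlow Ω μ γ b (fun x => -χ x) v₂ p₂
  mass_transfer : ∀ x ∈ Ω, χ x = -(β / μ) * (p₁ x - p₂ x)

end DoublePorosity

end

/-! Let `q i` and `w i` be the differences of the pressures and of the discharges, and put F = q₁w₁
+ q₂w₂. The momentum balances give ∇q_i = -μ φ_i K_i⁻¹(v_i - v_i'), so div F = ∑ ∇q_i·w_i - (β/μ)(q₁
- q₂)² is a sum of nonpositive terms, as K_i⁻¹ is positive definite. On the regular boundary F·n =
0: the normal part of w_i vanishes on Γ_i^v, and q_i on Γ_i^p. Hence ∫ div F = 0, every term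
vanishes, v_i = v_i' and q₁ = q₂. Then ∇q_i = 0, and connectedness makes both pressure differences
the same constant, which is 0 once a pressure is prescribed somewhere.

The work lies in the divergence theorem: F is only continuous up to ∂Ω, div F need not be integrable
a priori, and ∂Ω has a singular set. As div F ≤ 0, the one-sided bound `HasFluxBound` suffices. Near
a regular point (`exists_ball_hasFluxBound`) the test function is cut off in a layer of thickness
1/m. The cutoff gradient is of order m, the layer has volume O(1/m), and ∇g·F tends to 0 there;
Fatou's lemma treats the other side. A partition of unity globalises this
(`hasFluxBound_of_disjoint`). The singular set is compact and null for (n-1)-dimensional measure, so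
a cutoff with arbitrarily small ∫|∇η| removes it (`exists_cutoff`). `divergence_eq_zero_of_nonpos`
combines these. -/

namespace DoublePorosity

/-! ### Integration by parts, and the volume of boundary layers -/

/-- Integration by parts for the divergence against a compactly supported test function. -/
theorem integral_mul_divergence {n : ℕ} {U : Set (Space n)} (hU : IsOpen U)
    {F : Space n → Space n} (hF : ContDiffOn ℝ 1 F U) {ζ : Space n → ℝ} (hζ : ContDiff ℝ 1 ζ)
    (hc : HasCompactSupport ζ) (hs : tsupport ζ ⊆ U) :
    Integrable (fun x => ζ x * divergence F x) ∧ Integrable (fun x => fderiv ℝ ζ x (F x)) ∧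
      ∫ x, ζ x * divergence F x = -∫ x, fderiv ℝ ζ x (F x) := by
  have hd : ∀ x ∈ U, DifferentiableAt ℝ F x := fun x hx =>
    (hF.differentiableOn one_ne_zero).differentiableAt (hU.mem_nhds hx)
  have hcont : ∀ j : Fin n, ContinuousOn (fun x => F x j) U := fun j =>
    (EuclideanSpace.proj j : Space n →L[ℝ] ℝ).continuous.comp_continuousOn hF.continuousOn
  have hcomp : ∀ (j : Fin n), ∀ x ∈ U, ∀ v,
      fderiv ℝ (fun y => F y j) x v = (fderiv ℝ F x v) j := by
    intro j x hx v
    have := ((EuclideanSpace.proj j : Space n →L[ℝ] ℝ).hasFDerivAt.comp x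
      (hd x hx).hasFDerivAt).fderiv
    exact congrArg (fun T => T v) this
  have hdc : ∀ (j : Fin n) (v : Space n), ContinuousOn (fun x => (fderiv ℝ F x v) j) U := by
    intro j v
    have h1 : ContinuousOn (fderiv ℝ F) U := hF.continuousOn_fderiv_of_isOpen hU le_rfl
    exact (EuclideanSpace.proj j : Space n →L[ℝ] ℝ).continuous.comp_continuousOn
      (h1.clm_apply continuousOn_const)
  have hζd : Continuous (fderiv ℝ ζ) := hζ.continuous_fderiv one_ne_zero
  have hleft : ∀ j : Fin n, Integrable
      (fun x => ζ x * fderiv ℝ (fun y => F y j) x (EuclideanSpace.single j 1)) := by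
    intro j
    refine Continuous.integrable_of_hasCompactSupport ?_ hc.mul_right
    refine ContinuousOn.continuous_of_tsupport_subset ?_ hU
      ((tsupport_mul_subset_left).trans hs)
    refine hζ.continuous.continuousOn.mul ((hdc j _).congr fun x hx => hcomp j x hx _)
  have hright : ∀ j : Fin n, Integrable
      (fun x => fderiv ℝ ζ x (EuclideanSpace.single j 1) * F x j) := by
    intro j
    have hc' : HasCompactSupport (fun x => fderiv ℝ ζ x (EuclideanSpace.single j (1 : ℝ))) :=
      hc.fderiv_apply (𝕜 := ℝ) _
    refine Continuous.integrable_of_hasCompactSupport ?_ hc'.mul_right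
    refine ContinuousOn.continuous_of_tsupport_subset ?_ hU
      ((tsupport_mul_subset_left).trans ((tsupport_fderiv_apply_subset ℝ _).trans hs))
    exact (hζd.clm_apply continuous_const).continuousOn.mul (hcont j)
  have hprod : ∀ j : Fin n, Integrable (fun x => ζ x * F x j) := by
    intro j
    refine Continuous.integrable_of_hasCompactSupport ?_ hc.mul_right
    exact ContinuousOn.continuous_of_tsupport_subset (hζ.continuous.continuousOn.mul (hcont j)) hU
      ((tsupport_mul_subset_left).trans hs)
  have hparts : ∀ j : Fin n,
      ∫ x, ζ x * fderiv ℝ (fun y => F y j) x (EuclideanSpace.single j 1) =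
        -∫ x, fderiv ℝ ζ x (EuclideanSpace.single j 1) * F x j := by
    intro j
    refine integral_mul_fderiv_eq_neg_fderiv_mul_of_integrable (hright j) (hleft j) (hprod j)
      (fun x _ => hζ.differentiable one_ne_zero x) (fun x hx => ?_)
    exact ((EuclideanSpace.proj j : Space n →L[ℝ] ℝ).hasFDerivAt.comp x
      (hd x (hs hx)).hasFDerivAt).differentiableAt
  have e1 : (fun x => ζ x * divergence F x) = fun x => ∑ j : Fin n,
      ζ x * fderiv ℝ (fun y => F y j) x (EuclideanSpace.single j 1) := by
    funext x
    by_cases hx : x ∈ U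
    · simp only [divergence, Finset.mul_sum]
      exact Finset.sum_congr rfl fun j _ => by rw [hcomp j x hx]
    -- Off `U` the derivative of `F` is uncontrolled, but there `ζ` kills both sides.
    · have : ζ x = 0 := image_eq_zero_of_notMem_tsupport fun h => hx (hs h)
      simp [this]
  have e2 : (fun x => fderiv ℝ ζ x (F x)) = fun x => ∑ j : Fin n,
      fderiv ℝ ζ x (EuclideanSpace.single j 1) * F x j := by
    funext x
    conv_lhs => rw [← (EuclideanSpace.basisFun (Fin n) ℝ).sum_repr (F x)]
    simp [mul_comm]
  rw [e1, e2]
  refine ⟨integrable_finsetSum _ fun j _ => hleft j, integrable_finsetSum _ fun j _ => hright j, ?_⟩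
  rw [integral_finsetSum _ fun j _ => hleft j, integral_finsetSum _ fun j _ => hright j,
    ← Finset.sum_neg_distrib]
  exact Finset.sum_congr rfl fun j _ => hparts j

/-- Along the gradient direction a `C¹` function grows at a positive rate near a point where its
gradient does not vanish. -/
theorem exists_ball_linear_growth {E : Type*} [NormedAddCommGroup E] [InnerProductSpace ℝ E]
    [CompleteSpace E] {g : E → ℝ} {x : E} (hg : ContDiffAt ℝ 1 g x) (h0 : gradient g x ≠ 0) :
    ∃ r > 0, ∃ c > 0, ∃ e : E, ‖e‖ = 1 ∧ (∀ y ∈ Metric.ball x r, ContDiffAt ℝ 1 g y) ∧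
      (∀ y ∈ Metric.ball x r, gradient g y ≠ 0) ∧
      ∀ y ∈ Metric.ball x r, ∀ t : ℝ, 0 ≤ t → y + t • e ∈ Metric.ball x r →
        g y + c * t ≤ g (y + t • e) := by
  set e : E := ‖gradient g x‖⁻¹ • gradient g x with he
  have hpos : 0 < ‖gradient g x‖ := norm_pos_iff.2 h0
  have hxe : fderiv ℝ g x e = ‖gradient g x‖ := by
    rw [← inner_gradient_left, he, inner_smul_right, real_inner_self_eq_norm_sq]
    field_simp
  have hev1 : ∀ᶠ y in 𝓝 x, ContDiffAt ℝ 1 g y := hg.eventually (by simp)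
  have hcd : ContinuousAt (fderiv ℝ g) x := hg.continuousAt_fderiv one_ne_zero
  -- By continuity half of the slope at `x` survives nearby; this half is the growth rate.
  have hev2 : ∀ᶠ y in 𝓝 x, ‖gradient g x‖ / 2 < fderiv ℝ g y e := by
    have : ContinuousAt (fun y => fderiv ℝ g y e) x := hcd.clm_apply continuousAt_const
    exact this.eventually (lt_mem_nhds (by simpa only [hxe] using half_lt_self hpos))
  obtain ⟨r, hr, hball⟩ := Metric.eventually_nhds_iff_ball.1 (hev1.and hev2)
  refine ⟨r, hr, ‖gradient g x‖ / 2, by positivity, e, ?_, fun y hy => (hball y hy).1, ?_, ?_⟩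
  · rw [he, norm_smul, norm_inv, norm_norm, inv_mul_cancel₀ hpos.ne']
  · intro y hy h
    have := (hball y hy).2
    rw [← inner_gradient_left, h, inner_zero_left] at this
    linarith
  · intro y hy t ht hyt
    have hseg : ∀ s ∈ Icc (0 : ℝ) t, y + s • e ∈ Metric.ball x r := by
      intro s hs
      rcases eq_or_lt_of_le ht with h | h
      · have : s = 0 := le_antisymm (h ▸ hs.2) hs.1
        simpa [this] using hy
      · have := (convex_ball x r).add_smul_sub_mem hy hyt
          (t := s / t) ⟨div_nonneg hs.1 ht, (div_le_one h).2 hs.2⟩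
        simpa [smul_smul, div_mul_cancel₀ _ h.ne'] using this
    have hder : ∀ s ∈ Icc (0 : ℝ) t,
        HasDerivAt (fun s : ℝ => g (y + s • e)) (fderiv ℝ g (y + s • e) e) s := by
      intro s hs
      have h1 : HasDerivAt (fun s : ℝ => y + s • e) e s := by
        simpa using ((hasDerivAt_id s).smul_const e).const_add y
      exact (((hball _ (hseg s hs)).1.differentiableAt one_ne_zero).hasFDerivAt).comp_hasDerivAt s h1
    have := (convex_Icc (0 : ℝ) t).mul_sub_le_image_sub_of_le_deriv
      (f := fun s : ℝ => g (y + s • e)) (C := ‖gradient g x‖ / 2)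
      (fun s hs => (hder s hs).continuousAt.continuousWithinAt)
      (fun s hs => (hder s (interior_subset hs)).differentiableAt.differentiableWithinAt)
      (fun s hs => by
        rw [(hder s (interior_subset hs)).deriv]
        exact (hball _ (hseg s (interior_subset hs))).2.le)
      0 (left_mem_Icc.2 ht) t (right_mem_Icc.2 ht) ht
    simp only [sub_zero, zero_smul, add_zero] at this
    linarith

/-- The layer `-δ < g < 0` has measure `O(δ)` when `g` grows linearly in a fixed direction:
many translates of it are disjoint. -/
theorem measure_layer_le {E : Type*} [NormedAddCommGroup E] [NormedSpace ℝ E]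
    [MeasurableSpace E] [BorelSpace E] (ν : Measure E) [ν.IsAddLeftInvariant] {g : E → ℝ}
    {x e : E} {r c : ℝ} (hr : 0 < r) (hc : 0 < c) (he : ‖e‖ = 1)
    (hcont : ContinuousOn g (Metric.ball x (2 * r)))
    (hgrow : ∀ y ∈ Metric.ball x (2 * r), ∀ t : ℝ, 0 ≤ t → y + t • e ∈ Metric.ball x (2 * r) →
        g y + c * t ≤ g (y + t • e)) {δ : ℝ} (hδ : 0 < δ) :
    ν {y ∈ Metric.ball x r | -δ < g y ∧ g y < 0} ≤
      ENNReal.ofReal (δ / (r * c)) * ν (Metric.ball x (2 * r)) := by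
  set S : Set E := {y ∈ Metric.ball x r | -δ < g y ∧ g y < 0} with hS
  have hSm : MeasurableSet S := by
    have : IsOpen (Metric.ball x r ∩ g ⁻¹' Ioo (-δ) 0) :=
      (hcont.mono (Metric.ball_subset_ball (by linarith))).isOpen_inter_preimage
        Metric.isOpen_ball isOpen_Ioo
    exact this.measurableSet
  have hsub : Metric.ball x r ⊆ Metric.ball x (2 * r) := Metric.ball_subset_ball (by linarith)
  -- A shift by `δ / c` along `e` raises `g` by at least `δ`, the thickness of the layer, so
  -- distinct multiples give disjoint translates. Up to `N` shifts move points by at most `r`, so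
  -- all `N + 1` translates stay in the doubled ball.
  set N : ℕ := ⌊r * c / δ⌋₊ with hN
  set T : ℕ → Set E := fun k => (fun y => -((k * (δ / c)) • e) + y) ⁻¹' S with hT
  have hTm : ∀ k, MeasurableSet (T k) := fun k => (measurable_const_add _) hSm
  have hTν : ∀ k, ν (T k) = ν S := fun k => measure_preimage_add ν _ S
  have hdisj : ∀ k l : ℕ, k < l → Disjoint (T k) (T l) := by
    intro k l hkl
    refine Set.disjoint_left.2 fun z hk hl => ?_
    have hkl' : (1 : ℝ) ≤ (l : ℝ) - k := by
      have : (k : ℝ) + 1 ≤ l := by exact_mod_cast hkl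
      linarith
    have heq : (-((l * (δ / c)) • e) + z) + (((l : ℝ) - k) * (δ / c)) • e =
        -((k * (δ / c)) • e) + z := by
      rw [sub_mul, sub_smul]; abel
    have h1 := hgrow _ (hsub hl.1) (((l : ℝ) - k) * (δ / c)) (by positivity)
      (by rw [heq]; exact hsub hk.1)
    rw [heq] at h1
    have h2 : δ ≤ c * (((l : ℝ) - k) * (δ / c)) := by
      have : c * (((l : ℝ) - k) * (δ / c)) = ((l : ℝ) - k) * δ := by field_simp
      rw [this]; nlinarith
    have h3 := hk.2.2
    have h4 := hl.2.1
    linarith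
  have hTsub : ∀ k ∈ Finset.range (N + 1), T k ⊆ Metric.ball x (2 * r) := by
    intro k hk z hz
    have hkN : (k : ℝ) ≤ r * c / δ :=
      (Nat.cast_le.2 (Nat.lt_succ_iff.1 (Finset.mem_range.1 hk))).trans
        (Nat.floor_le (by positivity))
    have h1 : dist (-((k * (δ / c)) • e) + z) x < r := hz.1
    have h2 : ‖(k * (δ / c)) • e‖ ≤ r := by
      rw [norm_smul, he, mul_one, Real.norm_of_nonneg (by positivity)]
      calc k * (δ / c) ≤ r * c / δ * (δ / c) := by gcongr
        _ = r := by field_simp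
    rw [Metric.mem_ball]
    calc dist z x ≤ dist z (-((k * (δ / c)) • e) + z) + dist (-((k * (δ / c)) • e) + z) x :=
          dist_triangle _ _ _
      _ < r + r := by
          have : dist z (-((k * (δ / c)) • e) + z) = ‖(k * (δ / c)) • e‖ := by
            rw [dist_eq_norm]; congr 1; abel
          linarith
      _ = 2 * r := by ring
  have hsum : ((N + 1 : ℕ) : ENNReal) * ν S ≤ ν (Metric.ball x (2 * r)) := by
    calc ((N + 1 : ℕ) : ENNReal) * ν S = ∑ k ∈ Finset.range (N + 1), ν (T k) := by
          simp [hTν]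
      _ = ν (⋃ k ∈ Finset.range (N + 1), T k) := by
          refine (measure_biUnion_finset ?_ fun k _ => hTm k).symm
          intro k _ l _ hkl
          rcases lt_or_gt_of_ne hkl with h | h
          · exact hdisj k l h
          · exact (hdisj l k h).symm
      _ ≤ _ := measure_mono (iUnion₂_subset hTsub)
  have hN1 : 1 ≤ ENNReal.ofReal (δ / (r * c)) * ((N + 1 : ℕ) : ENNReal) := by
    rw [← ENNReal.ofReal_natCast, ← ENNReal.ofReal_mul (by positivity), ← ENNReal.ofReal_one]
    refine ENNReal.ofReal_le_ofReal ?_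
    have : r * c / δ ≤ ((N + 1 : ℕ) : ℝ) := by
      push_cast; exact (Nat.lt_floor_add_one _).le
    calc (1 : ℝ) = δ / (r * c) * (r * c / δ) := by field_simp
      _ ≤ _ := by gcongr
  calc ν S = 1 * ν S := (one_mul _).symm
    _ ≤ (ENNReal.ofReal (δ / (r * c)) * ((N + 1 : ℕ) : ENNReal)) * ν S := by gcongr
    _ = ENNReal.ofReal (δ / (r * c)) * (((N + 1 : ℕ) : ENNReal) * ν S) := mul_assoc _ _ _
    _ ≤ _ := by gcongr

end DoublePorosity

/-! ### The flux bound near a regular boundary point -/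

namespace DoublePorosity

/-- The part of `K` where `|a| ≥ ε` is compact and misses the zeros of `g`, so `|g|` has a positive
minimum on it, which serves as `δ`. It makes the normal flux uniformly small in thin layers. -/
theorem exists_abs_lt_of_eq_zero_imp {X : Type*} [TopologicalSpace X] {K : Set X}
    (hK : IsCompact K) {a g : X → ℝ} (ha : ContinuousOn a K) (hg : ContinuousOn g K)
    (h : ∀ y ∈ K, g y = 0 → a y = 0) {ε : ℝ} (hε : 0 < ε) :
    ∃ δ > 0, ∀ y ∈ K, |g y| < δ → |a y| < ε := by
  obtain ⟨t, ht, hteq⟩ := continuousOn_iff_isClosed.1 ha.abs (Ici ε) isClosed_Ici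
  have hc : IsCompact (t ∩ K) := hK.inter_left ht
  have hmem : ∀ y ∈ K, (y ∈ t ↔ ε ≤ |a y|) := by
    intro y hy
    have : y ∈ (fun x => |a x|) ⁻¹' Ici ε ∩ K ↔ y ∈ t ∩ K := by rw [hteq]
    simpa [hy] using this.symm
  rcases (t ∩ K).eq_empty_or_nonempty with he | hne
  · refine ⟨1, one_pos, fun y hy _ => ?_⟩
    by_contra hcon
    have : y ∈ t ∩ K := ⟨(hmem y hy).2 (not_lt.1 hcon), hy⟩
    simp [he] at this
  · obtain ⟨z, hz, hmin⟩ := hc.exists_isMinOn hne (hg.abs.mono inter_subset_right)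
    refine ⟨|g z|, abs_pos.2 fun h0 => ?_, fun y hy hlt => ?_⟩
    · have := (hmem z hz.2).1 hz.1
      rw [h z hz.2 h0, abs_zero] at this
      linarith
    · by_contra hcon
      exact absurd (hmin (show y ∈ t ∩ K from ⟨(hmem y hy).2 (not_lt.1 hcon), hy⟩))
        (not_le.2 hlt)

/-- The derivative is continuous and vanishes outside [0, 1]. The bound controls the cutoff
gradients uniformly in the layer thickness. -/
theorem exists_abs_deriv_smoothTransition_le :
    ∃ C : ℝ, ∀ t, |deriv Real.smoothTransition t| ≤ C := by
  have hd : Continuous (deriv Real.smoothTransition) :=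
    (Real.smoothTransition.contDiff (n := 1)).continuous_deriv le_rfl
  have hs : HasCompactSupport (deriv Real.smoothTransition) := by
    refine HasCompactSupport.intro (isCompact_Icc (a := (0 : ℝ)) (b := 1)) fun t ht => ?_
    rcases lt_or_ge t 0 with h | h
    · have : Real.smoothTransition =ᶠ[𝓝 t] fun _ => 0 := by
        filter_upwards [gt_mem_nhds h] with s hs using Real.smoothTransition.zero_of_nonpos hs.le
      rw [this.deriv_eq, deriv_const]
    · have h1 : 1 < t := not_le.1 fun h1 => ht ⟨h, h1⟩
      have : Real.smoothTransition =ᶠ[𝓝 t] fun _ => 1 := by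
        filter_upwards [lt_mem_nhds h1] with s hs using Real.smoothTransition.one_of_one_le hs.le
      rw [this.deriv_eq, deriv_const]
  exact hs.exists_bound_of_continuous hd

theorem integrableOn_fderiv_apply {n : ℕ} {Ω : Set (Space n)} (hb : Bornology.IsBounded Ω)
    {F : Space n → Space n} (hF : ContinuousOn F (closure Ω)) {ψ : Space n → ℝ}
    (hψ : ContDiff ℝ 1 ψ) : IntegrableOn (fun x => fderiv ℝ ψ x (F x)) Ω := by
  have : ContinuousOn (fun x => fderiv ℝ ψ x (F x)) (closure Ω) :=
    (hψ.continuous_fderiv one_ne_zero).continuousOn.clm_apply hF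
  exact (this.integrableOn_compact hb.isCompact_closure).mono_set subset_closure

/-- The weak form of `∫_Ω ψ (-div F) ≤ ∫_Ω ∇ψ ⬝ F`, which expresses that no flux of `F` leaves
`Ω` within the support of the test function `ψ`. -/
def HasFluxBound {n : ℕ} (Ω : Set (Space n)) (F : Space n → Space n) (ψ : Space n → ℝ) : Prop :=
  0 ≤ ∫ x in Ω, fderiv ℝ ψ x (F x) ∧
    ∫⁻ x in Ω, ENNReal.ofReal (ψ x * -divergence F x) ≤
      ENNReal.ofReal (∫ x in Ω, fderiv ℝ ψ x (F x))

/-- A test function compactly supported in `Ω`: both sides of the flux bound agree. -/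
theorem lintegral_mul_neg_divergence {n : ℕ} {Ω : Set (Space n)} (hΩ : IsOpen Ω)
    {F : Space n → Space n} (hF : ContDiffOn ℝ 1 F Ω) (hdiv : ∀ x ∈ Ω, divergence F x ≤ 0)
    {ζ : Space n → ℝ} (hζ : ContDiff ℝ 1 ζ) (h0 : ∀ x, 0 ≤ ζ x)
    (hc : HasCompactSupport ζ) (hs : tsupport ζ ⊆ Ω) :
    0 ≤ ∫ x in Ω, fderiv ℝ ζ x (F x) ∧
    ∫⁻ x in Ω, ENNReal.ofReal (ζ x * -divergence F x) =
      ENNReal.ofReal (∫ x in Ω, fderiv ℝ ζ x (F x)) := by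
  obtain ⟨hi, -, heq⟩ := integral_mul_divergence hΩ hF hζ hc hs
  have hnn : ∀ x ∈ Ω, 0 ≤ ζ x * -divergence F x := fun x hx =>
    mul_nonneg (h0 x) (neg_nonneg.2 (hdiv x hx))
  have hi' : Integrable (fun x => ζ x * -divergence F x) := by simpa using hi.neg
  have e1 : ∫ x in Ω, fderiv ℝ ζ x (F x) = ∫ x, fderiv ℝ ζ x (F x) := by
    refine setIntegral_eq_integral_of_forall_compl_eq_zero fun x hx => ?_
    have : fderiv ℝ ζ x = 0 := image_eq_zero_of_notMem_tsupport
      fun h => hx (hs (tsupport_fderiv_subset ℝ h))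
    simp [this]
  have e2 : ∫ x in Ω, ζ x * -divergence F x = ∫ x, ζ x * -divergence F x := by
    refine setIntegral_eq_integral_of_forall_compl_eq_zero fun x hx => ?_
    have : ζ x = 0 := image_eq_zero_of_notMem_tsupport fun h => hx (hs h)
    simp [this]
  have e3 : ∫ x in Ω, fderiv ℝ ζ x (F x) = ∫ x in Ω, ζ x * -divergence F x := by
    rw [e1, e2]
    simp only [mul_neg, integral_neg]
    rw [heq, neg_neg]
  rw [e3]
  exact ⟨setIntegral_nonneg hΩ.measurableSet hnn,
    (ofReal_integral_eq_lintegral_ofReal hi'.integrableOn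
      ((ae_restrict_iff' hΩ.measurableSet).2 (ae_of_all _ hnn))).symm⟩

/-- Near a regular boundary point with vanishing normal component of `F`, the flux bound holds. -/
theorem exists_ball_hasFluxBound {n : ℕ} {Ω : Set (Space n)} (hΩ : IsOpen Ω)
    (hb : Bornology.IsBounded Ω) {F : Space n → Space n} (hF : ContDiffOn ℝ 1 F Ω)
    (hFc : ContinuousOn F (closure Ω)) (hdiv : ∀ x ∈ Ω, divergence F x ≤ 0)
    (hflux : ∀ x ν, IsOutwardUnitNormal Ω x ν → inner ℝ (F x) ν = 0)
    {x₀ ν₀ : Space n} (hx₀ : IsOutwardUnitNormal Ω x₀ ν₀) :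
    ∃ r > 0, ∀ ψ : Space n → ℝ, ContDiff ℝ 1 ψ → (∀ x, 0 ≤ ψ x) →
      tsupport ψ ⊆ Metric.ball x₀ r → HasFluxBound Ω F ψ := by
  obtain ⟨-, g, hg, hg0, hgΩ, -⟩ := hx₀
  obtain ⟨r₁, hr₁, c, hc, e, he, hgd, hgn, hgrow⟩ := exists_ball_linear_growth hg hg0
  obtain ⟨r₂, hr₂, hgΩ⟩ := Metric.eventually_nhds_iff_ball.1 hgΩ
  obtain ⟨r, hr, hrr₁, hrr₂⟩ : ∃ r > 0, 2 * r ≤ r₁ ∧ 2 * r ≤ r₂ :=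
    ⟨min r₁ r₂ / 2, by positivity, by linarith [min_le_left r₁ r₂],
      by linarith [min_le_right r₁ r₂]⟩
  have hB₁ : Metric.ball x₀ (2 * r) ⊆ Metric.ball x₀ r₁ := Metric.ball_subset_ball hrr₁
  have hBB : Metric.ball x₀ r ⊆ Metric.ball x₀ (2 * r) := Metric.ball_subset_ball (by linarith)
  replace hgd := fun y hy => hgd y (hB₁ hy)
  replace hgn := fun y hy => hgn y (hB₁ hy)
  replace hgΩ := fun y (hy : y ∈ Metric.ball x₀ (2 * r)) =>
    hgΩ y (Metric.ball_subset_ball hrr₂ hy)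
  have hgcont : ContinuousOn g (Metric.ball x₀ (2 * r)) := fun y hy =>
    (hgd y hy).continuousAt.continuousWithinAt
  -- The one function `g` defines `Ω` near each of its zeros in the ball, so the flux hypothesis
  -- applies at all of them, not only at `x₀`.
  have hnormal : ∀ y ∈ Metric.ball x₀ (2 * r), y ∈ closure Ω → g y = 0 →
      fderiv ℝ g y (F y) = 0 := by
    intro y hy hyc hy0
    have hyΩ : y ∉ Ω := fun h => by linarith [(hgΩ y hy).1 h]
    have hfr : y ∈ frontier Ω := by rw [hΩ.frontier_eq]; exact ⟨hyc, hyΩ⟩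
    have h1 := hflux y _ ⟨hfr, g, hgd y hy, hgn y hy, by
      filter_upwards [Metric.isOpen_ball.mem_nhds hy] with z hz using hgΩ z hz, rfl⟩
    rw [inner_smul_right] at h1
    have h2 := (mul_eq_zero.1 h1).resolve_left (inv_ne_zero (norm_ne_zero_iff.2 (hgn y hy)))
    rw [← inner_gradient_left, real_inner_comm]
    exact h2
  set κ : ℝ := (volume (Metric.ball x₀ (2 * r))).toReal / (r * c) with hκ
  have hκ0 : 0 ≤ κ := by positivity
  have hlayer : ∀ δ : ℝ, 0 < δ →
      volume.real (Metric.ball x₀ r ∩ g ⁻¹' Ioo (-δ) 0) ≤ δ * κ := by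
    intro δ hδ
    have h1 := measure_layer_le volume hr hc he hgcont
      (fun y hy t ht hyt => hgrow y (hB₁ hy) t ht (hB₁ hyt)) hδ
    have h2 := ENNReal.toReal_mono (ENNReal.mul_ne_top ENNReal.ofReal_ne_top
      measure_ball_lt_top.ne) h1
    rw [ENNReal.toReal_mul, ENNReal.toReal_ofReal (by positivity)] at h2
    calc volume.real (Metric.ball x₀ r ∩ g ⁻¹' Ioo (-δ) 0) ≤ _ := h2
      _ = δ * κ := by rw [hκ]; ring
  refine ⟨r, hr, fun ψ hψ hψ0 hψs => ?_⟩
  have hψs' : tsupport ψ ⊆ Metric.ball x₀ (2 * r) := hψs.trans hBB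
  have hψc : IsCompact (tsupport ψ) :=
    (isCompact_closedBall x₀ r).of_isClosed_subset (isClosed_tsupport ψ)
      (hψs.trans Metric.ball_subset_closedBall)
  have hψz : ∀ y, y ∉ Metric.ball x₀ r → ψ =ᶠ[𝓝 y] fun _ => 0 := fun y hy =>
    notMem_tsupport_iff_eventuallyEq.1 fun h => hy (hψs h)
  set σ := Real.smoothTransition with hσ
  -- `ζ m` vanishes where `g ≥ -1/(m+1)` and equals `ψ` where `g ≤ -2/(m+1)`: the cutoff happens
  -- strictly inside `Ω`.
  set ζ : ℕ → Space n → ℝ := fun m y => ψ y * σ (-(m + 1) * g y - 1) with hζdef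
  have hζz : ∀ m y, y ∉ Metric.ball x₀ r → ζ m =ᶠ[𝓝 y] fun _ => 0 := fun m y hy => by
    filter_upwards [hψz y hy] with z hz
    simp only [hζdef, hz, zero_mul]
  have hζ0 : ∀ m x, 0 ≤ ζ m x := fun m x => mul_nonneg (hψ0 x) (Real.smoothTransition.nonneg _)
  have hζC : ∀ m, ContDiff ℝ 1 (ζ m) := by
    intro m
    refine contDiff_iff_contDiffAt.2 fun y => ?_
    by_cases hy : y ∈ Metric.ball x₀ r
    · refine hψ.contDiffAt.mul ?_
      exact (Real.smoothTransition.contDiff (n := 1)).contDiffAt.comp y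
        ((contDiffAt_const.mul (hgd y (hBB hy))).sub contDiffAt_const)
    · exact contDiffAt_const.congr_of_eventuallyEq (hζz m y hy)
  have hζsub : ∀ m, tsupport (ζ m) ⊆ tsupport ψ := fun m => tsupport_mul_subset_left
  have hζc : ∀ m, HasCompactSupport (ζ m) := fun m =>
    hψc.of_isClosed_subset (isClosed_tsupport _) (hζsub m)
  have hζs : ∀ m, tsupport (ζ m) ⊆ Ω := by
    intro m
    have hcl : IsClosed (tsupport ψ ∩ g ⁻¹' Iic (-(1 / ((m : ℝ) + 1)))) :=
      (hgcont.mono hψs').preimage_isClosed_of_isClosed (isClosed_tsupport ψ) isClosed_Iic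
    have : tsupport (ζ m) ⊆ tsupport ψ ∩ g ⁻¹' Iic (-(1 / ((m : ℝ) + 1))) := by
      refine closure_minimal (fun y hy => ⟨subset_tsupport ψ (left_ne_zero_of_mul hy), ?_⟩) hcl
      have h1 : 0 < -((m : ℝ) + 1) * g y - 1 := by
        by_contra hcon
        exact right_ne_zero_of_mul hy (Real.smoothTransition.zero_of_nonpos (not_lt.1 hcon))
      have h2 : (0 : ℝ) < m + 1 := by positivity
      show g y ≤ -(1 / ((m : ℝ) + 1))
      rw [le_neg, div_le_iff₀ h2]
      linarith
    intro y hy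
    obtain ⟨h1, h2⟩ := this hy
    refine (hgΩ y (hψs' h1)).2 (lt_of_le_of_lt h2 ?_)
    have : (0 : ℝ) < 1 / (m + 1) := by positivity
    linarith
  obtain ⟨C, hC⟩ := exists_abs_deriv_smoothTransition_le
  have hC0 : 0 ≤ C := (abs_nonneg _).trans (hC 0)
  obtain ⟨M, hM0, hM⟩ : ∃ M ≥ 0, ∀ y ∈ closure Ω, |fderiv ℝ ψ y (F y)| ≤ M := by
    obtain ⟨M, hM⟩ := hb.isCompact_closure.exists_bound_of_continuousOn
      ((hψ.continuous_fderiv one_ne_zero).continuousOn.clm_apply hFc)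
    exact ⟨max M 0, le_max_right _ _, fun y hy => (hM y hy).trans (le_max_left _ _)⟩
  have hfd : ∀ m, ∀ y ∈ Metric.ball x₀ r, fderiv ℝ (ζ m) y (F y) - fderiv ℝ ψ y (F y) =
      (σ (-(m + 1) * g y - 1) - 1) * fderiv ℝ ψ y (F y) -
        (m + 1) * (deriv σ (-(m + 1) * g y - 1) * (ψ y * fderiv ℝ g y (F y))) := by
    intro m y hy
    have h1 : HasFDerivAt g (fderiv ℝ g y) y :=
      ((hgd y (hBB hy)).differentiableAt one_ne_zero).hasFDerivAt
    have h2 : HasFDerivAt ψ (fderiv ℝ ψ y) y := (hψ.differentiable one_ne_zero y).hasFDerivAt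
    have h3 : HasDerivAt σ (deriv σ (-(m + 1) * g y - 1)) (-(m + 1) * g y - 1) :=
      ((Real.smoothTransition.contDiff (n := 1)).differentiable one_ne_zero _).hasDerivAt
    have h4 := h2.mul (h3.comp_hasFDerivAt y ((h1.const_mul (-((m : ℝ) + 1))).sub_const 1))
    have h5 := congrArg (fun T : Space n →L[ℝ] ℝ => T (F y)) h4.fderiv
    have h6 : fderiv ℝ (ζ m) y (F y) = _ := h5
    rw [h6]
    simp
    ring
  have hlim : Tendsto (fun m : ℕ => ∫ x in Ω, fderiv ℝ (ζ m) x (F x)) atTop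
      (𝓝 (∫ x in Ω, fderiv ℝ ψ x (F x))) := by
    refine Metric.tendsto_atTop'.2 fun ε hε => ?_
    -- The layer used below has volume at most `3κ/(m+1)`, so the term with factor `(m+1) * C`
    -- contributes at most `3κC` times this number, hence at most `ε/2`. The `+ 1` avoids division
    -- by zero.
    have hA : 0 < ε / (2 * (3 * κ * C + 1)) := by positivity
    obtain ⟨δ, hδ, hδa⟩ := exists_abs_lt_of_eq_zero_imp
      (hb.isCompact_closure.inter_left (isClosed_tsupport ψ))
      (a := fun y => ψ y * fderiv ℝ g y (F y)) (g := g)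
      (hψ.continuous.continuousOn.mul (ContinuousOn.clm_apply (fun y hy =>
        ((hgd y (hψs' hy.1)).continuousAt_fderiv one_ne_zero).continuousWithinAt)
          (hFc.mono inter_subset_right)))
      (hgcont.mono (inter_subset_left.trans hψs'))
      (fun y hy h => by simp only [hnormal y (hψs' hy.1) hy.2 h, mul_zero]) hA
    -- The first bound forces `|g| < δ` in the layer; the second makes the term with `M` less than
    -- `ε/2`.
    obtain ⟨m₀, hm₀⟩ := exists_nat_gt (max (3 / δ) (6 * κ * M / ε))
    refine ⟨m₀, fun m hm => ?_⟩
    have hmm : max (3 / δ) (6 * κ * M / ε) < (m : ℝ) + 1 :=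
      hm₀.trans (by have : (m₀ : ℝ) < m := Nat.cast_lt.2 hm
                    linarith)
    have hm1 : (0 : ℝ) < m + 1 := by positivity
    have hmδ : 3 / ((m : ℝ) + 1) < δ := by
      have := (le_max_left _ _).trans_lt hmm
      rw [div_lt_iff₀ hδ] at this
      rw [div_lt_iff₀ hm1]; linarith
    have hmM : 3 * κ * M / (m + 1) < ε / 2 := by
      have := (le_max_right _ _).trans_lt hmm
      rw [div_lt_iff₀ hε] at this
      rw [div_lt_iff₀ hm1]; linarith
    -- Width 3 rather than 2 leaves a margin: off `T`, `ζ m` and `ψ` agree in a whole neighbourhood,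
    -- so their derivatives agree.
    set T : Set (Space n) := Ω ∩ (Metric.ball x₀ r ∩ g ⁻¹' Ioo (-(3 / ((m : ℝ) + 1))) 0) with hT
    have hTfin : volume T < ⊤ :=
      (measure_mono (inter_subset_right.trans inter_subset_left)).trans_lt measure_ball_lt_top
    have hTκ : volume.real T ≤ 3 / ((m : ℝ) + 1) * κ :=
      (measureReal_mono inter_subset_right
        ((measure_mono inter_subset_left).trans_lt measure_ball_lt_top).ne).trans
        (hlayer _ (by positivity))
    rw [dist_eq_norm, ← integral_sub (integrableOn_fderiv_apply hb hFc (hζC m))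
      (integrableOn_fderiv_apply hb hFc hψ)]
    have hzero : ∀ y ∈ Ω \ T, fderiv ℝ (ζ m) y (F y) - fderiv ℝ ψ y (F y) = 0 := by
      rintro y ⟨hyΩ, hyT⟩
      have heq : ζ m =ᶠ[𝓝 y] ψ := by
        by_cases hy : y ∈ Metric.ball x₀ r
        · have hgy : g y < -(2 / ((m : ℝ) + 1)) := by
            have h1 : ¬ -(3 / ((m : ℝ) + 1)) < g y := fun h =>
              hyT ⟨hyΩ, hy, h, (hgΩ y (hBB hy)).1 hyΩ⟩
            have h2 : 2 / ((m : ℝ) + 1) < 3 / ((m : ℝ) + 1) := by gcongr; norm_num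
            linarith [not_lt.1 h1]
          filter_upwards [(hgd y (hBB hy)).continuousAt.eventually (gt_mem_nhds hgy)] with z hz
          have h3 : 1 ≤ -((m : ℝ) + 1) * g z - 1 := by
            rw [lt_neg, div_lt_iff₀ hm1] at hz
            linarith
          simp only [hζdef, hσ, Real.smoothTransition.one_of_one_le h3, mul_one]
        · exact (hζz m y hy).trans (hψz y hy).symm
      rw [heq.fderiv_eq, sub_self]
    rw [setIntegral_eq_of_subset_of_forall_sdiff_eq_zero (μ := volume) (s := T)
      hΩ.measurableSet inter_subset_left hzero]
    have hbound : ∀ y ∈ T, ‖fderiv ℝ (ζ m) y (F y) - fderiv ℝ ψ y (F y)‖ ≤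
        M + (m + 1) * (C * (ε / (2 * (3 * κ * C + 1)))) := by
      rintro y ⟨hyΩ, hyB, hy1, hy2⟩
      rw [hfd m y hyB, Real.norm_eq_abs]
      have b1 : |σ (-(m + 1) * g y - 1) - 1| ≤ 1 := by
        rw [abs_le]
        constructor <;>
          linarith [Real.smoothTransition.nonneg (-((m : ℝ) + 1) * g y - 1),
            Real.smoothTransition.le_one (-((m : ℝ) + 1) * g y - 1)]
      have b2 : |ψ y * fderiv ℝ g y (F y)| ≤ ε / (2 * (3 * κ * C + 1)) := by
        by_cases hy : y ∈ tsupport ψ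
        · exact (hδa y ⟨hy, subset_closure hyΩ⟩ (by rw [abs_of_neg hy2]; linarith)).le
        · rw [image_eq_zero_of_notMem_tsupport hy, zero_mul, abs_zero]; exact hA.le
      refine (abs_sub _ _).trans ?_
      rw [abs_mul, abs_mul, abs_mul, abs_of_pos hm1]
      gcongr
      · calc _ ≤ 1 * M := by gcongr; exact hM y (subset_closure hyΩ)
          _ = M := one_mul M
      · exact hC _
    calc _ ≤ (M + (m + 1) * (C * (ε / (2 * (3 * κ * C + 1))))) * volume.real T :=
          norm_setIntegral_le_of_norm_le_const hTfin hbound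
      _ ≤ (M + (m + 1) * (C * (ε / (2 * (3 * κ * C + 1))))) * (3 / ((m : ℝ) + 1) * κ) := by
          gcongr
      _ = 3 * κ * M / (m + 1) + 3 * κ * C / (3 * κ * C + 1) * (ε / 2) := by
          field_simp
      _ < ε / 2 + 1 * (ε / 2) := by
          refine add_lt_add_of_lt_of_le hmM ?_
          gcongr
          rw [div_le_one (by positivity)]
          linarith
      _ = ε := by ring
  have hpt : ∀ x ∈ Ω, Tendsto (fun m : ℕ => ζ m x) atTop (𝓝 (ψ x)) := by
    intro x hx
    by_cases hxB : x ∈ Metric.ball x₀ r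
    · have hgx : 0 < -g x := neg_pos.2 ((hgΩ x (hBB hxB)).1 hx)
      refine tendsto_const_nhds.congr' ?_
      filter_upwards [eventually_ge_atTop ⌈2 / -g x⌉₊] with m hm
      have h1 : 2 / -g x ≤ m := Nat.ceil_le.1 hm
      rw [div_le_iff₀ hgx] at h1
      have h2 : 1 ≤ -((m : ℝ) + 1) * g x - 1 := by linarith
      simp only [hζdef, hσ, Real.smoothTransition.one_of_one_le h2, mul_one]
    · have h1 : ψ x = 0 := (hψz x hxB).eq_of_nhds
      simp [hζdef, h1]
  constructor
  · exact ge_of_tendsto' hlim fun m =>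
      (lintegral_mul_neg_divergence hΩ hF hdiv (hζC m) (hζ0 m) (hζc m) (hζs m)).1
  -- Fatou's lemma needs only nonnegative integrands, so no integrability of the divergence up to
  -- the boundary is assumed.
  · have hfat := lintegral_liminf_le' (μ := volume.restrict Ω)
      (f := fun (m : ℕ) x => ENNReal.ofReal (ζ m x * -divergence F x)) (fun m => by
        have := (integral_mul_divergence hΩ hF (hζC m) (hζc m) (hζs m)).1
        refine AEMeasurable.ennreal_ofReal ?_
        simpa using this.1.aemeasurable.restrict (s := Ω)) (u := atTop)
    have hl : ∀ x ∈ Ω, liminf (fun m : ℕ => ENNReal.ofReal (ζ m x * -divergence F x)) atTop =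
        ENNReal.ofReal (ψ x * -divergence F x) := fun x hx =>
      (ENNReal.tendsto_ofReal ((hpt x hx).mul_const _)).liminf_eq
    rw [setLIntegral_congr_fun hΩ.measurableSet hl] at hfat
    refine hfat.trans (le_of_eq ?_)
    simp_rw [fun m => (lintegral_mul_neg_divergence hΩ hF hdiv (hζC m) (hζ0 m) (hζc m)
      (hζs m)).2]
    exact (ENNReal.tendsto_ofReal hlim).liminf_eq

end DoublePorosity

/-! ### Globalisation away from the singular boundary -/

namespace DoublePorosity

/-- Regularity is an open condition on the frontier: a defining function at a point, with nonzero
gradient, also serves at all nearby frontier points. -/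
theorem isClosed_setOf_not_regular {n : ℕ} (Ω : Set (Space n)) :
    IsClosed {x ∈ frontier Ω | ¬ ∃ ν, IsOutwardUnitNormal Ω x ν} := by
  refine isClosed_of_closure_subset fun x hx => ?_
  have hxf : x ∈ frontier Ω :=
    isClosed_frontier.closure_subset_iff.2 (fun y hy => hy.1) hx
  refine ⟨hxf, ?_⟩
  rintro ⟨ν, -, g, hg, hg0, hgΩ, -⟩
  obtain ⟨r, hr, -, -, -, -, hgd, hgn, -⟩ := exists_ball_linear_growth hg hg0
  obtain ⟨y, hyU, hyf, hyn⟩ := mem_closure_iff_nhds.1 hx _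
    ((hgΩ.eventually_nhds).and (Metric.ball_mem_nhds x hr))
  exact hyn ⟨_, hyf, g, hgd y hyU.2, hgn y hyU.2, hyU.1, rfl⟩

/-- The flux bound holds for test functions supported away from the singular boundary points. -/
theorem hasFluxBound_of_disjoint {n : ℕ} {Ω : Set (Space n)} (hΩ : IsOpen Ω)
    (hb : Bornology.IsBounded Ω) {F : Space n → Space n} (hF : ContDiffOn ℝ 1 F Ω)
    (hFc : ContinuousOn F (closure Ω)) (hdiv : ∀ x ∈ Ω, divergence F x ≤ 0)
    (hflux : ∀ x ν, IsOutwardUnitNormal Ω x ν → inner ℝ (F x) ν = 0)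
    {η : Space n → ℝ} (hη : ContDiff ℝ 1 η) (h0 : ∀ x, 0 ≤ η x)
    (hdis : Disjoint (tsupport η) {x ∈ frontier Ω | ¬ ∃ ν, IsOutwardUnitNormal Ω x ν}) :
    HasFluxBound Ω F η := by
  -- `η` need not have compact support; only this compact part matters, and each of its points is
  -- interior or regular.
  set S := closure Ω ∩ tsupport η with hS
  have hSc : IsCompact S := hb.isCompact_closure.inter_right (isClosed_tsupport η)
  have hloc : ∀ x ∈ S, ∃ r > 0, ∀ ψ : Space n → ℝ, ContDiff ℝ 1 ψ → (∀ x, 0 ≤ ψ x) →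
      tsupport ψ ⊆ Metric.ball x r → HasFluxBound Ω F ψ := by
    intro x hx
    by_cases hxΩ : x ∈ Ω
    · obtain ⟨r, hr, hball⟩ := Metric.isOpen_iff.1 hΩ x hxΩ
      refine ⟨r, hr, fun ψ hψ hψ0 hψs => ?_⟩
      have hc : HasCompactSupport ψ := (isCompact_closedBall x r).of_isClosed_subset
        (isClosed_tsupport ψ) (hψs.trans Metric.ball_subset_closedBall)
      have := lintegral_mul_neg_divergence hΩ hF hdiv hψ hψ0 hc (hψs.trans hball)
      exact ⟨this.1, this.2.le⟩
    · have hfr : x ∈ frontier Ω := by rw [hΩ.frontier_eq]; exact ⟨hx.1, hxΩ⟩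
      obtain ⟨ν, hν⟩ : ∃ ν, IsOutwardUnitNormal Ω x ν := by
        by_contra hcon
        exact Set.disjoint_left.1 hdis hx.2 ⟨hfr, hcon⟩
      exact exists_ball_hasFluxBound hΩ hb hF hFc hdiv hflux hν
  choose! r hr hr' using hloc
  obtain ⟨t, htS, ht⟩ := hSc.elim_nhds_subcover (fun x => Metric.ball x (r x))
    fun x hx => Metric.ball_mem_nhds x (hr x hx)
  obtain ⟨f, hf⟩ := SmoothPartitionOfUnity.exists_isSubordinate (modelWithCornersSelf ℝ (Space n))
    hSc.isClosed (fun i : t => Metric.ball (i : Space n) (r i)) (fun _ => Metric.isOpen_ball)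
    (by simpa only [iUnion_subtype] using ht)
  have hfC : ∀ i, ContDiff ℝ 1 (fun x => f i x * η x) := fun i =>
    ((f i).contMDiff.contDiff.of_le (by simp)).mul hη
  have hff : ∀ i : t, HasFluxBound Ω F (fun x => f i x * η x) := fun i =>
    hr' i (htS i i.2) _ (hfC i) (fun x => mul_nonneg (f.nonneg i x) (h0 x))
      ((tsupport_mul_subset_left).trans (hf i))
  have hsum : ∀ x ∈ Ω, η x = ∑ i, f i x * η x := by
    intro x hx
    by_cases hx0 : η x = 0
    · simp [hx0]
    · have := f.sum_eq_one (show x ∈ S from ⟨subset_closure hx, subset_tsupport η hx0⟩)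
      rw [finsum_eq_sum_of_fintype] at this
      rw [← Finset.sum_mul, this, one_mul]
  have hint : ∫ x in Ω, fderiv ℝ η x (F x) =
      ∑ i, ∫ x in Ω, fderiv ℝ (fun x => f i x * η x) x (F x) := by
    rw [← integral_finsetSum _ fun i _ => integrableOn_fderiv_apply hb hFc (hfC i)]
    refine setIntegral_congr_fun hΩ.measurableSet fun x hx => ?_
    have h1 : η =ᶠ[𝓝 x] fun x => ∑ i, f i x * η x := by
      filter_upwards [hΩ.mem_nhds hx] with y hy using hsum y hy
    show fderiv ℝ η x (F x) = _
    rw [h1.fderiv_eq, fderiv_fun_sum fun i _ => (hfC i).differentiable one_ne_zero x]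
    simp
  rw [HasFluxBound, hint]
  refine ⟨Finset.sum_nonneg fun i _ => (hff i).1, ?_⟩
  rw [ENNReal.ofReal_sum_of_nonneg fun i _ => (hff i).1]
  refine le_trans ?_ (Finset.sum_le_sum fun i _ => (hff i).2)
  have hdm : ContinuousOn (divergence F) Ω := by
    refine continuousOn_finsetSum _ fun j _ => ?_
    exact (EuclideanSpace.proj j : Space n →L[ℝ] ℝ).continuous.comp_continuousOn
      ((hF.continuousOn_fderiv_of_isOpen hΩ le_rfl).clm_apply continuousOn_const)
  rw [← lintegral_finsetSum' _ fun i _ => ?_]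
  · refine le_of_eq (setLIntegral_congr_fun hΩ.measurableSet fun x hx => ?_)
    show ENNReal.ofReal (η x * -divergence F x) = _
    rw [← ENNReal.ofReal_sum_of_nonneg fun i _ => mul_nonneg
      (mul_nonneg (f.nonneg i x) (h0 x)) (neg_nonneg.2 (hdiv x hx)), ← Finset.sum_mul, ← hsum x hx]
  · exact (((hfC i).continuous.continuousOn.mul hdm.neg).aemeasurable
      hΩ.measurableSet).ennreal_ofReal

/-- A finite product of functions `1 - bᵢ` with `0 ≤ bᵢ ≤ 1`. -/
theorem norm_fderiv_prod_one_sub_le {E ι : Type*} [NormedAddCommGroup E] [NormedSpace ℝ E]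
    {b : ι → E → ℝ} (hb : ∀ i, Differentiable ℝ (b i)) (h0 : ∀ i x, 0 ≤ b i x)
    (h1 : ∀ i x, b i x ≤ 1) (t : Finset ι) (x : E) :
    ‖fderiv ℝ (fun x => ∏ i ∈ t, (1 - b i x)) x‖ ≤ ∑ i ∈ t, ‖fderiv ℝ (b i) x‖ := by
  classical
  induction t using Finset.induction_on with
  | empty => simp
  | insert a t ha ih =>
    have hP : DifferentiableAt ℝ (fun x => ∏ i ∈ t, (1 - b i x)) x :=
      (HasFDerivAt.finsetProd fun i _ =>
        ((hb i x).const_sub 1).hasFDerivAt).differentiableAt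
    simp only [Finset.prod_insert ha, Finset.sum_insert ha]
    rw [fderiv_fun_mul ((hb a x).const_sub 1) hP, fderiv_const_sub, add_comm]
    have hP0 : 0 ≤ ∏ i ∈ t, (1 - b i x) := Finset.prod_nonneg fun i _ => by linarith [h1 i x]
    have hP1 : ∏ i ∈ t, (1 - b i x) ≤ 1 :=
      Finset.prod_le_one (fun i _ => by linarith [h1 i x]) fun i _ => by linarith [h0 i x]
    refine (norm_add_le _ _).trans (add_le_add ?_ ?_)
    · rw [norm_smul, norm_neg, Real.norm_of_nonneg hP0]
      exact mul_le_of_le_one_left (norm_nonneg _) hP1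
    · rw [norm_smul, Real.norm_of_nonneg (by linarith [h1 a x])]
      exact (mul_le_of_le_one_left (norm_nonneg _) (by linarith [h0 a x])).trans ih

end DoublePorosity

/-! ### Removing the singular set, and the divergence theorem -/

namespace DoublePorosity

/-- A compact `μH[d]`-null set has finite covers by small balls with small `∑ rᵢ ^ d`. -/
theorem exists_finite_ball_cover {X : Type*} [MetricSpace X] [MeasurableSpace X] [BorelSpace X]
    [Nonempty X] {E : Set X} (hE : IsCompact E) {d : ℝ} (h : μH[d] E = 0) {ε : ENNReal}
    (hd : 0 ≤ d) (hε : 0 < ε) {ρ : ℝ} (hρ : 0 < ρ) :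
    ∃ (t : Finset ℕ) (c : ℕ → X) (r : ℕ → ℝ), (∀ i ∈ t, c i ∈ E ∧ 0 < r i ∧ r i < ρ) ∧
      E ⊆ ⋃ i ∈ t, Metric.ball (c i) (r i) ∧ ∑ i ∈ t, ENNReal.ofReal (r i) ^ d ≤ ε := by
  have hε2 : 0 < ε / 2 := ENNReal.half_pos hε.ne'
  have hρ2 : ENNReal.ofReal (ρ / 2) < ENNReal.ofReal ρ :=
    (ENNReal.ofReal_lt_ofReal_iff hρ).2 (half_lt_self hρ)
  rw [Measure.hausdorffMeasure_apply] at h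
  have h1 := (iSup₂_eq_bot.1 h) (ENNReal.ofReal (ρ / 2)) (ENNReal.ofReal_pos.2 (by positivity))
  have h2 := lt_of_eq_of_lt h1 hε2
  simp only [iInf_lt_iff] at h2
  obtain ⟨s, hsE, hsd, hsum⟩ := h2
  -- Half of `ε` pays for the covering sets. The other half pays for radii slightly above the
  -- diameters, needed because the balls are open and a diameter may be 0.
  obtain ⟨δ, hδ, hδsum⟩ := ENNReal.exists_pos_sum_of_countable' hε2.ne' ℕ
  have hex : ∀ i, (s i ∩ E).Nonempty → ∃ (x : X) (r : ℝ), x ∈ E ∧ 0 < r ∧ r < ρ ∧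
      s i ⊆ Metric.ball x r ∧ ENNReal.ofReal r ^ d ≤ Metric.ediam (s i) ^ d + δ i := by
    rintro i ⟨x, hxs, hxE⟩
    have hat : Metric.ediam (s i) < ENNReal.ofReal ρ := (hsd i).trans_lt hρ2
    have hne : Metric.ediam (s i) ≠ ⊤ := (hat.trans ENNReal.ofReal_lt_top).ne
    have hlt : Metric.ediam (s i) ^ d < Metric.ediam (s i) ^ d + δ i :=
      ENNReal.lt_add_right (ENNReal.rpow_ne_top_of_nonneg hd hne) (hδ i).ne'
    have hev : ∀ᶠ y in 𝓝[>] Metric.ediam (s i),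
        y ^ d < Metric.ediam (s i) ^ d + δ i ∧ y < ENNReal.ofReal ρ ∧ Metric.ediam (s i) < y :=
      ((ENNReal.continuous_rpow_const.tendsto _).eventually (gt_mem_nhds hlt)
        |>.filter_mono nhdsWithin_le_nhds).and
        (((gt_mem_nhds hat : ∀ᶠ y in 𝓝 _, y < _).filter_mono nhdsWithin_le_nhds).and
          self_mem_nhdsWithin)
    have : (𝓝[>] Metric.ediam (s i)).NeBot := nhdsGT_neBot_of_exists_gt ⟨_, hat⟩
    obtain ⟨y, hy1, hy2, hy3⟩ := hev.exists
    have hyt : y ≠ ⊤ := (hy2.trans ENNReal.ofReal_lt_top).ne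
    refine ⟨x, y.toReal, hxE, ENNReal.toReal_pos (pos_of_gt hy3).ne' hyt, ?_, ?_, ?_⟩
    · rwa [← ENNReal.ofReal_lt_ofReal_iff hρ, ENNReal.ofReal_toReal hyt]
    · intro z hz
      rw [Metric.mem_ball, dist_edist]
      exact (ENNReal.toReal_lt_toReal (edist_ne_top _ _) hyt).2
        ((Metric.edist_le_ediam_of_mem hz hxs).trans_lt hy3)
    · rw [ENNReal.ofReal_toReal hyt]
      exact hy1.le
  choose! c r hcE hr0 hrρ hsub hpow using hex
  obtain ⟨t, hts, htf, hcov⟩ := hE.elim_finite_subcover_image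
    (b := {i | (s i ∩ E).Nonempty}) (c := fun i => Metric.ball (c i) (r i))
    (fun i _ => Metric.isOpen_ball) (fun x hx => by
      obtain ⟨i, hi⟩ := mem_iUnion.1 (hsE hx)
      exact mem_iUnion₂.2 ⟨i, ⟨x, hi, hx⟩, hsub i ⟨x, hi, hx⟩ hi⟩)
  refine ⟨htf.toFinset, c, r, fun i hi => ?_, by simpa using hcov, ?_⟩
  · have := hts (htf.mem_toFinset.1 hi)
    exact ⟨hcE i this, hr0 i this, hrρ i this⟩
  · calc ∑ i ∈ htf.toFinset, ENNReal.ofReal (r i) ^ d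
        ≤ ∑ i ∈ htf.toFinset, ((⨆ _ : (s i).Nonempty, Metric.ediam (s i) ^ d) + δ i) := by
          refine Finset.sum_le_sum fun i hi => ?_
          have := hts (htf.mem_toFinset.1 hi)
          refine (hpow i this).trans ?_
          gcongr
          exact le_iSup (fun _ : (s i).Nonempty => Metric.ediam (s i) ^ d)
            (this.mono inter_subset_left)
      _ ≤ ε / 2 + ε / 2 := by
          rw [Finset.sum_add_distrib]
          exact add_le_add ((ENNReal.sum_le_tsum _).trans hsum.le)
            ((ENNReal.sum_le_tsum _).trans hδsum.le)
      _ = ε := ENNReal.add_halves ε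

/-- Compact sets of vanishing `(n-1)`-dimensional measure can be cut off at small cost. -/
theorem exists_cutoff {n : ℕ} (hn : 1 ≤ n) {E : Set (Space n)} (hE : IsCompact E)
    (h : μH[(n : ℝ) - 1] E = 0) {ε : ENNReal} (hε : 0 < ε) {ρ : ℝ} (hρ : 0 < ρ) :
    ∃ η : Space n → ℝ, ContDiff ℝ 1 η ∧ (∀ x, 0 ≤ η x) ∧ Disjoint (tsupport η) E ∧
      (∀ x, (∀ y ∈ E, ρ ≤ dist x y) → η x = 1) ∧ ∫⁻ x, ‖fderiv ℝ η x‖ₑ ≤ ε := by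
  let b : ContDiffBump (0 : Space n) := ⟨1, 2, one_pos, one_lt_two⟩
  have hbC : ContDiff ℝ 1 b := b.contDiff
  obtain ⟨C, hC⟩ := (b.hasCompactSupport.fderiv (𝕜 := ℝ)).exists_bound_of_continuous
    (hbC.continuous_fderiv one_ne_zero)
  have hC0 : 0 ≤ C := (norm_nonneg _).trans (hC 0)
  -- A bump rescaled to radius `r` has gradient at most `C / r`, supported in a ball of radius `2r`;
  -- its integral is thus at most `κ * r ^ (n - 1)`.
  set κ : ENNReal := ENNReal.ofReal (C * 2 ^ n) * volume (Metric.ball (0 : Space n) 1) with hκ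
  have hκt : κ ≠ ⊤ := ENNReal.mul_ne_top ENNReal.ofReal_ne_top measure_ball_lt_top.ne
  have hκt1 : κ + 1 ≠ ⊤ := ENNReal.add_ne_top.2 ⟨hκt, ENNReal.one_ne_top⟩
  -- Radii stay below `ρ / 2` because the bumps reach out to `2r`; `κ + 1` is a nonzero divisor.
  obtain ⟨t, c, r, ht, hcov, hsum⟩ := exists_finite_ball_cover hE h (ε := ε / (κ + 1))
    (sub_nonneg.2 (by exact_mod_cast hn)) (ENNReal.div_pos hε.ne' hκt1) (half_pos hρ)
  set B : ℕ → Space n → ℝ := fun i x => b ((r i)⁻¹ • (x - c i)) with hB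
  have hBC : ∀ i, ContDiff ℝ 1 (B i) := fun i =>
    hbC.comp ((contDiff_id.sub contDiff_const).const_smul (r i)⁻¹)
  have hB0 : ∀ i x, 0 ≤ B i x := fun i x => b.nonneg
  have hB1 : ∀ i x, B i x ≤ 1 := fun i x => b.le_one
  have hscale : ∀ i ∈ t, ∀ x, ‖(r i)⁻¹ • (x - c i)‖ = dist x (c i) / r i := by
    intro i hi x
    rw [norm_smul, norm_inv, Real.norm_of_nonneg (ht i hi).2.1.le, dist_eq_norm,
      div_eq_inv_mul]
  have hBint : ∀ i ∈ t, ∫⁻ x, ‖fderiv ℝ (B i) x‖ₑ ≤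
      κ * ENNReal.ofReal (r i) ^ ((n : ℝ) - 1) := by
    intro i hi
    have hri := (ht i hi).2.1
    have hle : ∀ x, ‖fderiv ℝ (B i) x‖ₑ ≤
        (Metric.closedBall (c i) (2 * r i)).indicator (fun _ => ENNReal.ofReal (C / r i)) x := by
      intro x
      by_cases hx : x ∈ Metric.closedBall (c i) (2 * r i)
      · rw [indicator_of_mem hx, ← ofReal_norm]
        refine ENNReal.ofReal_le_ofReal ?_
        have h1 : HasFDerivAt (fun x : Space n => (r i)⁻¹ • (x - c i))
            ((r i)⁻¹ • ContinuousLinearMap.id ℝ (Space n)) x :=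
          ((hasFDerivAt_id x).sub_const (c i)).fun_const_smul (r i)⁻¹
        have h2 := ((hbC.differentiable one_ne_zero _).hasFDerivAt.comp x h1).fderiv
        have h3 : fderiv ℝ (B i) x = _ := h2
        rw [h3, ContinuousLinearMap.comp_smul, ContinuousLinearMap.comp_id, norm_smul, norm_inv,
          Real.norm_of_nonneg hri.le, div_eq_inv_mul]
        gcongr
        exact hC _
      · rw [indicator_of_notMem hx]
        have hx' : 2 * r i < dist x (c i) := not_le.1 hx
        have : B i =ᶠ[𝓝 x] fun _ => 0 := by
          filter_upwards [(continuous_id.dist continuous_const).continuousAt.eventually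
            (lt_mem_nhds hx')] with y hy
          refine b.zero_of_le_dist ?_
          rw [dist_zero_right, hscale i hi, le_div_iff₀ hri]
          exact hy.le
        rw [this.fderiv_eq, fderiv_const_apply, ← ofReal_norm, norm_zero,
          ENNReal.ofReal_zero]
    refine (lintegral_mono hle).trans ?_
    rw [lintegral_indicator_const Metric.isClosed_closedBall.measurableSet,
      Measure.addHaar_closedBall _ _ (by positivity), finrank_euclideanSpace_fin, hκ,
      ENNReal.ofReal_rpow_of_pos hri, ← mul_assoc,
      ← ENNReal.ofReal_mul (by positivity), mul_right_comm (ENNReal.ofReal (C * 2 ^ n)),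
      ← ENNReal.ofReal_mul (by positivity)]
    refine le_of_eq ?_
    congr 2
    rw [Real.rpow_sub_one hri.ne', Real.rpow_natCast, mul_pow]
    field_simp
  refine ⟨fun x => ∏ i ∈ t, (1 - B i x), contDiff_prod fun i _ => contDiff_const.sub (hBC i),
    fun x => Finset.prod_nonneg fun i _ => by linarith [hB1 i x], ?_, ?_, ?_⟩
  · refine Set.disjoint_right.2 fun x hx => notMem_tsupport_iff_eventuallyEq.2 ?_
    obtain ⟨i, hi, hxi⟩ := mem_iUnion₂.1 (hcov hx)
    filter_upwards [Metric.isOpen_ball.mem_nhds hxi] with y hy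
    refine Finset.prod_eq_zero hi (sub_eq_zero.2 (b.one_of_mem_closedBall ?_).symm)
    rw [mem_closedBall_zero_iff, hscale i hi, div_le_iff₀ (ht i hi).2.1]
    exact (Metric.mem_ball.1 hy).le.trans_eq (one_mul _).symm
  · intro x hx
    refine Finset.prod_eq_one fun i hi => ?_
    obtain ⟨hci, hri, hrρ⟩ := ht i hi
    have : B i x = 0 := by
      refine b.zero_of_le_dist ?_
      rw [dist_zero_right, hscale i hi, le_div_iff₀ hri]
      show 2 * r i ≤ _
      linarith [hx _ hci]
    rw [this, sub_zero]
  · calc ∫⁻ x, ‖fderiv ℝ (fun x => ∏ i ∈ t, (1 - B i x)) x‖ₑ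
        ≤ ∫⁻ x, ∑ i ∈ t, ‖fderiv ℝ (B i) x‖ₑ := by
          refine lintegral_mono fun x => ?_
          simp_rw [← ofReal_norm]
          rw [← ENNReal.ofReal_sum_of_nonneg fun i _ => norm_nonneg _]
          exact ENNReal.ofReal_le_ofReal (norm_fderiv_prod_one_sub_le
            (fun i => (hBC i).differentiable one_ne_zero) hB0 hB1 t x)
      _ = ∑ i ∈ t, ∫⁻ x, ‖fderiv ℝ (B i) x‖ₑ := lintegral_finsetSum _ fun i _ =>
          ((hBC i).continuous_fderiv one_ne_zero).enorm.measurable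
      _ ≤ ∑ i ∈ t, κ * ENNReal.ofReal (r i) ^ ((n : ℝ) - 1) := Finset.sum_le_sum hBint
      _ ≤ (κ + 1) * (ε / (κ + 1)) := by
          rw [← Finset.mul_sum]
          gcongr
          exact le_self_add
      _ = ε := ENNReal.mul_div_cancel (by simp) hκt1

/-- A field with nonpositive divergence and no flux through the regular boundary is
divergence-free. -/
theorem divergence_eq_zero_of_nonpos {n : ℕ} (hn : 1 ≤ n) {Ω : Set (Space n)} (hΩ : IsOpen Ω)
    (hb : Bornology.IsBounded Ω) (hs : HasPiecewiseSmoothBoundary Ω) {F : Space n → Space n}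
    (hF : ContDiffOn ℝ 1 F Ω) (hFc : ContinuousOn F (closure Ω))
    (hdiv : ∀ x ∈ Ω, divergence F x ≤ 0)
    (hflux : ∀ x ν, IsOutwardUnitNormal Ω x ν → inner ℝ (F x) ν = 0) :
    ∀ x ∈ Ω, divergence F x = 0 := by
  intro x₀ hx₀
  by_contra hne
  set a : ℝ := -divergence F x₀ / 2 with ha
  have ha0 : 0 < a := by
    have := lt_of_le_of_ne (hdiv x₀ hx₀) hne
    rw [ha]; linarith
  have hdc : ContinuousAt (divergence F) x₀ := by
    refine ContinuousOn.continuousAt (continuousOn_finsetSum _ fun j _ => ?_) (hΩ.mem_nhds hx₀)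
    exact (EuclideanSpace.proj j : Space n →L[ℝ] ℝ).continuous.comp_continuousOn
      ((hF.continuousOn_fderiv_of_isOpen hΩ le_rfl).clm_apply continuousOn_const)
  have hev : ∀ᶠ x in 𝓝 x₀, x ∈ Ω ∧ divergence F x < -a :=
    (hΩ.eventually_mem hx₀).and (hdc.eventually (gt_mem_nhds (by rw [ha]; linarith)))
  obtain ⟨R, hR, hball⟩ := Metric.eventually_nhds_iff_ball.1 hev
  set E : Set (Space n) := {x ∈ frontier Ω | ¬ ∃ ν, IsOutwardUnitNormal Ω x ν} with hEdef
  have hE : IsCompact E := hb.isCompact_closure.of_isClosed_subset (isClosed_setOf_not_regular Ω)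
    fun x hx => frontier_subset_closure hx.1
  obtain ⟨M, hM⟩ := hb.isCompact_closure.exists_bound_of_continuousOn hFc
  -- `A` bounds the left side of the flux bound from below for every cutoff used: `ball x₀ R` lies
  -- in `Ω`, so points of the half ball are at distance at least `R / 2` from `E`, where `η = 1`.
  -- The cutoff is then chosen to make the right side at most `A / 2`.
  set A : ENNReal := ENNReal.ofReal a * volume (Metric.ball x₀ (R / 2)) with hA
  have hA0 : A ≠ 0 := mul_ne_zero (ENNReal.ofReal_pos.2 ha0).ne'
    (Metric.measure_ball_pos volume x₀ (half_pos hR)).ne'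
  have hAt : A ≠ ⊤ := ENNReal.mul_ne_top ENNReal.ofReal_ne_top measure_ball_lt_top.ne
  have hMt : ENNReal.ofReal M + 1 ≠ ⊤ := ENNReal.add_ne_top.2
    ⟨ENNReal.ofReal_ne_top, ENNReal.one_ne_top⟩
  obtain ⟨η, hη, hη0, hηE, hη1, hηint⟩ := exists_cutoff hn hE hs
    (ε := A / 2 / (ENNReal.ofReal M + 1))
    (ENNReal.div_pos (ENNReal.half_pos hA0).ne' hMt) (half_pos hR)
  have hbd := (hasFluxBound_of_disjoint hΩ hb hF hFc hdiv hflux hη hη0 hηE).2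
  have hlow : A ≤ ∫⁻ x in Ω, ENNReal.ofReal (η x * -divergence F x) := by
    have hsub : Metric.ball x₀ (R / 2) ⊆ Metric.ball x₀ R := Metric.ball_subset_ball (by linarith)
    calc A = ∫⁻ _ in Metric.ball x₀ (R / 2), ENNReal.ofReal a := by rw [setLIntegral_const]
      _ ≤ ∫⁻ x in Metric.ball x₀ (R / 2), ENNReal.ofReal (η x * -divergence F x) := by
          refine setLIntegral_mono' Metric.isOpen_ball.measurableSet fun x hx => ?_
          refine ENNReal.ofReal_le_ofReal ?_
          rw [hη1 x fun y hy => ?_, one_mul]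
          · linarith [(hball x (hsub hx)).2]
          · by_contra hcon
            have hy' : y ∈ Metric.ball x₀ R := by
              have h1 := Metric.mem_ball.1 hx
              rw [dist_comm] at hcon
              rw [Metric.mem_ball]
              linarith [dist_triangle y x x₀, not_le.1 hcon]
            have hyf := hy.1
            rw [hΩ.frontier_eq] at hyf
            exact hyf.2 (hball y hy').1
      _ ≤ _ := lintegral_mono_set fun x hx => (hball x (hsub hx)).1
  have hup : ENNReal.ofReal (∫ x in Ω, fderiv ℝ η x (F x)) ≤ A / 2 := by
    calc ENNReal.ofReal (∫ x in Ω, fderiv ℝ η x (F x))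
        ≤ ‖∫ x in Ω, fderiv ℝ η x (F x)‖ₑ := Real.ofReal_le_enorm _
      _ ≤ ∫⁻ x in Ω, ‖fderiv ℝ η x (F x)‖ₑ := enorm_integral_le_lintegral_enorm _
      _ ≤ ∫⁻ x in Ω, ENNReal.ofReal M * ‖fderiv ℝ η x‖ₑ := by
          refine setLIntegral_mono' hΩ.measurableSet fun x hx => ?_
          rw [mul_comm]
          refine (ContinuousLinearMap.le_opENorm _ _).trans ?_
          gcongr
          rw [← ofReal_norm]
          exact ENNReal.ofReal_le_ofReal (hM x (subset_closure hx))
      _ ≤ ∫⁻ x, ENNReal.ofReal M * ‖fderiv ℝ η x‖ₑ := setLIntegral_le_lintegral _ _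
      _ = ENNReal.ofReal M * ∫⁻ x, ‖fderiv ℝ η x‖ₑ :=
          lintegral_const_mul _ (hη.continuous_fderiv one_ne_zero).enorm.measurable
      _ ≤ (ENNReal.ofReal M + 1) * (A / 2 / (ENNReal.ofReal M + 1)) := by
          gcongr
          exact le_self_add
      _ = A / 2 := ENNReal.mul_div_cancel (by simp) hMt
  exact absurd (hlow.trans (hbd.trans hup)) (not_le.2 (ENNReal.half_lt_self hA0 hAt))

end DoublePorosity

/-! ### Differences of two solutions, and uniqueness -/

namespace DoublePorosity

theorem divergence_add {n : ℕ} {F G : Space n → Space n} {x : Space n}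
    (hF : DifferentiableAt ℝ F x) (hG : DifferentiableAt ℝ G x) :
    divergence (fun y => F y + G y) x = divergence F x + divergence G x := by
  simp [divergence, fderiv_fun_add hF hG, Finset.sum_add_distrib]

theorem divergence_sub {n : ℕ} {F G : Space n → Space n} {x : Space n}
    (hF : DifferentiableAt ℝ F x) (hG : DifferentiableAt ℝ G x) :
    divergence (fun y => F y - G y) x = divergence F x - divergence G x := by
  simp [divergence, fderiv_fun_sub hF hG, Finset.sum_sub_distrib]

theorem divergence_smul {n : ℕ} {q : Space n → ℝ} {F : Space n → Space n} {x : Space n}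
    (hq : DifferentiableAt ℝ q x) (hF : DifferentiableAt ℝ F x) :
    divergence (fun y => q y • F y) x = q x * divergence F x + fderiv ℝ q x (F x) := by
  have h : fderiv ℝ q x (F x) = ∑ j : Fin n, fderiv ℝ q x (EuclideanSpace.single j 1) * F x j := by
    conv_lhs => rw [← (EuclideanSpace.basisFun (Fin n) ℝ).sum_repr (F x)]
    simp [mul_comm]
  rw [h]
  simp [divergence, fderiv_fun_smul hq hF, Finset.sum_add_distrib, Finset.mul_sum]

/-- A kernel vector would make the form vanish, so `A` is invertible; with `w = A⁻¹ξ` the form of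
`A⁻¹` at `ξ` is ⟨w, Aw⟩. Symmetry plays no role. -/
theorem IsPositiveDefinite.inv {n : ℕ} {A : Matrix (Fin n) (Fin n) ℝ}
    (hA : IsPositiveDefinite A) : IsPositiveDefinite A⁻¹ := by
  have hdet : IsUnit A.det := by
    rw [isUnit_iff_ne_zero]
    intro h0
    obtain ⟨v, hv, hAv⟩ := Matrix.exists_mulVec_eq_zero_iff.2 h0
    have h1 := hA (WithLp.toLp 2 v) (fun h => hv (by simpa using congrArg WithLp.ofLp h))
    rw [Matrix.toLpLin_toLp] at h1
    simp [hAv] at h1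
  intro ξ hξ
  set w := Matrix.toEuclideanLin A⁻¹ ξ with hw
  have hAw : Matrix.toEuclideanLin A w = ξ := by
    rw [hw]
    ext i
    simp [Matrix.toLpLin_apply, Matrix.mulVec_mulVec, Matrix.mul_nonsing_inv A hdet]
  have hw0 : w ≠ 0 := fun h => hξ (by rw [← hAw, h, map_zero])
  have := hA w hw0
  rwa [hAw, real_inner_comm] at this

namespace Network

variable {n : ℕ} {N : Network n} {Ω : Set (Space n)} {μ γ : ℝ} {b : Space n → Space n}
  {s s' : Space n → ℝ} {v v' : Space n → Space n} {p p' : Space n → ℝ}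

/-- The pressure difference of two flows drives no flux of the velocity difference through the
boundary. -/
theorem IsClassicalFlow.inner_flux_eq_zero (hN : N.IsAdmissible Ω)
    (h : N.IsClassicalFlow Ω μ γ b s v p) (h' : N.IsClassicalFlow Ω μ γ b s' v' p')
    {x ν : Space n} (hν : IsOutwardUnitNormal Ω x ν) :
    inner ℝ ((p x - p' x) • (N.discharge v x - N.discharge v' x)) ν = 0 := by
  have hx : x ∈ N.Γv ∪ N.Γp := hN.boundary_union ▸ hν.1
  rw [inner_smul_left, discharge, discharge, ← smul_sub, inner_smul_left, inner_sub_left]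
  rcases hx with hx | hx
  · rw [h.velocity_bc x hx ν hν, h'.velocity_bc x hx ν hν]; simp
  · rw [h.pressure_bc x hx, h'.pressure_bc x hx]; simp

/-- The momentum balance for the difference of two flows. -/
theorem IsClassicalFlow.gradient_sub (hΩ : IsOpen Ω) (hN : N.IsAdmissible Ω)
    (h : N.IsClassicalFlow Ω μ γ b s v p) (h' : N.IsClassicalFlow Ω μ γ b s' v' p')
    {x : Space n} (hx : x ∈ Ω) :
    gradient (fun y => p y - p' y) x =
      -(μ * N.φ x) • Matrix.toEuclideanLin (N.K x)⁻¹ (v x - v' x) := by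
  have hφ := (hN.porosity_pos x (subset_closure hx)).ne'
  have hp := (h.pressure_contDiff.differentiableOn one_ne_zero).differentiableAt (hΩ.mem_nhds hx)
  have hp' := (h'.pressure_contDiff.differentiableOn one_ne_zero).differentiableAt (hΩ.mem_nhds hx)
  have hg : gradient (fun y => p y - p' y) x = gradient p x - gradient p' x := by
    simp only [gradient, fderiv_fun_sub hp hp', map_sub]
  have hm := (h.momentum x hx).trans (h'.momentum x hx).symm
  -- Multiplying by the nonzero porosity turns the claim into the difference of the two momentum
  -- balances.
  refine smul_right_injective (Space n) hφ ?_
  simp only [hg, map_sub, smul_sub]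
  rw [smul_smul, smul_smul, show N.φ x * -(μ * N.φ x) = -(μ * N.φ x ^ 2) by ring, neg_smul,
    neg_smul, sub_eq_sub_iff_add_eq_add]
  rw [← sub_eq_zero] at hm ⊢
  rw [← hm]
  abel

/-- The power of the pressure difference on the velocity difference is nonpositive. -/
theorem IsClassicalFlow.fderiv_apply_discharge_sub (hΩ : IsOpen Ω) (hμ : 0 < μ)
    (hN : N.IsAdmissible Ω) (h : N.IsClassicalFlow Ω μ γ b s v p)
    (h' : N.IsClassicalFlow Ω μ γ b s' v' p') {x : Space n} (hx : x ∈ Ω) :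
    fderiv ℝ (fun y => p y - p' y) x (N.discharge v x - N.discharge v' x) ≤ 0 ∧
      (fderiv ℝ (fun y => p y - p' y) x (N.discharge v x - N.discharge v' x) = 0 →
        v x = v' x) := by
  have hφ := hN.porosity_pos x (subset_closure hx)
  have hval : fderiv ℝ (fun y => p y - p' y) x (N.discharge v x - N.discharge v' x) =
      -(μ * N.φ x ^ 2) *
        inner ℝ (Matrix.toEuclideanLin (N.K x)⁻¹ (v x - v' x)) (v x - v' x) := by
    rw [← inner_gradient_left, h.gradient_sub hΩ hN h' hx, discharge, discharge, ← smul_sub,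
      inner_smul_left, inner_smul_right]
    simp only [conj_trivial]
    ring
  rw [hval]
  have hc : 0 < μ * N.φ x ^ 2 := by positivity
  by_cases hv : v x - v' x = 0
  · exact ⟨by simp [hv], fun _ => sub_eq_zero.1 hv⟩
  · have := mul_pos hc ((hN.permeability_pos x hx).inv _ hv)
    rw [neg_mul]
    exact ⟨by linarith, fun h0 => by linarith⟩

/-- Flows whose velocities agree in `Ω` have velocities agreeing on `closure Ω`, and their
pressures differ by a constant. -/
theorem IsClassicalFlow.eqOn_closure (hΩ : IsOpen Ω) (hΩc : IsConnected Ω)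
    (hN : N.IsAdmissible Ω) (h : N.IsClassicalFlow Ω μ γ b s v p)
    (h' : N.IsClassicalFlow Ω μ γ b s' v' p') (hv : EqOn v v' Ω) :
    EqOn v v' (closure Ω) ∧ ∃ c : ℝ, ∀ x ∈ closure Ω, p x = p' x + c := by
  constructor
  · have hd : EqOn (N.discharge v) (N.discharge v') (closure Ω) :=
      EqOn.of_subset_closure (fun x hx => by simp only [discharge, hv hx])
        h.discharge_continuous h'.discharge_continuous subset_closure subset_rfl
    exact fun x hx => smul_right_injective (Space n) (hN.porosity_pos x hx).ne' (hd hx)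
  · obtain ⟨x₀, hx₀⟩ := hΩc.nonempty
    have hdiff : DifferentiableOn ℝ (fun y => p y - p' y) Ω :=
      (h.pressure_contDiff.differentiableOn one_ne_zero).sub
        (h'.pressure_contDiff.differentiableOn one_ne_zero)
    have hzero : EqOn (fderiv ℝ fun y => p y - p' y) 0 Ω := by
      intro x hx
      have := h.gradient_sub hΩ hN h' hx
      rw [hv hx, sub_self, map_zero, smul_zero, gradient, map_eq_zero_iff _
        (InnerProductSpace.toDual ℝ (Space n)).symm.injective] at this
      exact this
    have hconst : EqOn (fun y => p y - p' y) (fun _ => p x₀ - p' x₀) Ω := fun x hx =>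
      hΩ.is_const_of_fderiv_eq_zero hΩc.isPreconnected hdiff hzero hx hx₀
    refine ⟨p x₀ - p' x₀, fun x hx => ?_⟩
    have := EqOn.of_subset_closure hconst
      (h.pressure_continuous.sub h'.pressure_continuous) continuousOn_const
      subset_closure subset_rfl hx
    simp only at this
    linarith

end Network

end DoublePorosity

theorem mainTheorem2 {n : ℕ} (hn : 1 ≤ n)
    (Ω : Set (DoublePorosity.Space n))
    (hΩo : IsOpen Ω) (hΩc : IsConnected Ω) (hΩb : Bornology.IsBounded Ω)
    (hΩs : DoublePorosity.HasPiecewiseSmoothBoundary Ω)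
    (N₁ N₂ : DoublePorosity.Network n)
    (hN₁ : N₁.IsAdmissible Ω) (hN₂ : N₂.IsAdmissible Ω)
    (μ β γ : ℝ) (hμ : 0 < μ) (hβ : 0 < β)
    (b : DoublePorosity.Space n → DoublePorosity.Space n)
    (v₁ v₂ v₁' v₂' : DoublePorosity.Space n → DoublePorosity.Space n)
    (p₁ p₂ χ p₁' p₂' χ' : DoublePorosity.Space n → ℝ)
    (h : DoublePorosity.IsClassicalSolution Ω N₁ N₂ μ β γ b v₁ v₂ p₁ p₂ χ)
    (h' : DoublePorosity.IsClassicalSolution Ω N₁ N₂ μ β γ b v₁' v₂' p₁' p₂' χ') :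
    Set.EqOn v₁ v₁' (closure Ω) ∧ Set.EqOn v₂ v₂' (closure Ω) ∧ Set.EqOn χ χ' Ω ∧
    (∃ c : ℝ, ∀ x ∈ closure Ω, p₁ x = p₁' x + c ∧ p₂ x = p₂' x + c) ∧
    ((N₁.Γp ∪ N₂.Γp).Nonempty →
      Set.EqOn p₁ p₁' (closure Ω) ∧ Set.EqOn p₂ p₂' (closure Ω)) := by
  obtain ⟨f₁, f₂, hχ⟩ := h
  obtain ⟨f₁', f₂', hχ'⟩ := h'
  set q₁ : DoublePorosity.Space n → ℝ := fun x => p₁ x - p₁' x with hq₁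
  set q₂ : DoublePorosity.Space n → ℝ := fun x => p₂ x - p₂' x with hq₂
  set w₁ : DoublePorosity.Space n → DoublePorosity.Space n :=
    fun x => N₁.discharge v₁ x - N₁.discharge v₁' x with hw₁
  set w₂ : DoublePorosity.Space n → DoublePorosity.Space n :=
    fun x => N₂.discharge v₂ x - N₂.discharge v₂' x with hw₂
  have cq₁ : ContDiffOn ℝ 1 q₁ Ω := f₁.pressure_contDiff.sub f₁'.pressure_contDiff
  have cq₂ : ContDiffOn ℝ 1 q₂ Ω := f₂.pressure_contDiff.sub f₂'.pressure_contDiff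
  have cw₁ : ContDiffOn ℝ 1 w₁ Ω := f₁.discharge_contDiff.sub f₁'.discharge_contDiff
  have cw₂ : ContDiffOn ℝ 1 w₂ Ω := f₂.discharge_contDiff.sub f₂'.discharge_contDiff
  -- The sources enter with opposite signs, so they contribute (q₁ - q₂)(χ - χ'), and the transfer
  -- law turns this into a negative square.
  have key : ∀ x ∈ Ω, DoublePorosity.divergence (fun y => q₁ y • w₁ y + q₂ y • w₂ y) x =
      fderiv ℝ q₁ x (w₁ x) + fderiv ℝ q₂ x (w₂ x) - β / μ * (q₁ x - q₂ x) ^ 2 := by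
    intro x hx
    have hxΩ := hΩo.mem_nhds hx
    have d : ∀ {G : Type} [NormedAddCommGroup G] [NormedSpace ℝ G]
        {f : DoublePorosity.Space n → G}, ContDiffOn ℝ 1 f Ω → DifferentiableAt ℝ f x :=
      fun hf => (hf.differentiableOn one_ne_zero).differentiableAt hxΩ
    rw [DoublePorosity.divergence_add ((d cq₁).fun_smul (d cw₁)) ((d cq₂).fun_smul (d cw₂)),
      DoublePorosity.divergence_smul (d cq₁) (d cw₁), DoublePorosity.divergence_smul (d cq₂) (d cw₂),
      DoublePorosity.divergence_sub (d f₁.discharge_contDiff) (d f₁'.discharge_contDiff),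
      DoublePorosity.divergence_sub (d f₂.discharge_contDiff) (d f₂'.discharge_contDiff),
      f₁.mass_balance x hx, f₁'.mass_balance x hx, f₂.mass_balance x hx, f₂'.mass_balance x hx,
      hχ x hx, hχ' x hx]
    simp only [hq₁, hq₂]
    ring
  have hβμ : 0 < β / μ := div_pos hβ hμ
  have hzero := DoublePorosity.divergence_eq_zero_of_nonpos hn hΩo hΩb hΩs
    (F := fun y => q₁ y • w₁ y + q₂ y • w₂ y) ((cq₁.smul cw₁).add (cq₂.smul cw₂))
    (((f₁.pressure_continuous.sub f₁'.pressure_continuous).smul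
        (f₁.discharge_continuous.sub f₁'.discharge_continuous)).add
      ((f₂.pressure_continuous.sub f₂'.pressure_continuous).smul
        (f₂.discharge_continuous.sub f₂'.discharge_continuous)))
    (fun x hx => by
      rw [key x hx]
      have h1 := (f₁.fderiv_apply_discharge_sub hΩo hμ hN₁ f₁' hx).1
      have h2 := (f₂.fderiv_apply_discharge_sub hΩo hμ hN₂ f₂' hx).1
      have h3 := mul_nonneg hβμ.le (sq_nonneg (q₁ x - q₂ x))
      linarith)
    (fun x ν hν => by
      rw [inner_add_left, f₁.inner_flux_eq_zero hN₁ f₁' hν, f₂.inner_flux_eq_zero hN₂ f₂' hν,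
        add_zero])
  have hall : ∀ x ∈ Ω, v₁ x = v₁' x ∧ v₂ x = v₂' x ∧ q₁ x = q₂ x := by
    intro x hx
    have h0 := hzero x hx
    -- Three nonpositive terms with sum 0 must each vanish.
    rw [key x hx] at h0
    obtain ⟨h1, e1⟩ := f₁.fderiv_apply_discharge_sub hΩo hμ hN₁ f₁' hx
    obtain ⟨h2, e2⟩ := f₂.fderiv_apply_discharge_sub hΩo hμ hN₂ f₂' hx
    have h3 := mul_nonneg hβμ.le (sq_nonneg (q₁ x - q₂ x))
    refine ⟨e1 (by linarith), e2 (by linarith), ?_⟩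
    have h4 : β / μ * (q₁ x - q₂ x) ^ 2 = 0 := by linarith
    exact sub_eq_zero.1 (pow_eq_zero_iff two_ne_zero |>.1
      ((mul_eq_zero.1 h4).resolve_left hβμ.ne'))
  obtain ⟨e₁, c₁, hc₁⟩ := f₁.eqOn_closure hΩo hΩc hN₁ f₁' fun x hx => (hall x hx).1
  obtain ⟨e₂, c₂, hc₂⟩ := f₂.eqOn_closure hΩo hΩc hN₂ f₂' fun x hx => (hall x hx).2.1
  obtain ⟨x₀, hx₀⟩ := hΩc.nonempty
  have hcc : c₁ = c₂ := by
    have h1 := (hall x₀ hx₀).2.2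
    simp only [hq₁, hq₂] at h1
    linarith [hc₁ x₀ (subset_closure hx₀), hc₂ x₀ (subset_closure hx₀)]
  subst hcc
  refine ⟨e₁, e₂, fun x hx => ?_, ⟨c₁, fun x hx => ⟨hc₁ x hx, hc₂ x hx⟩⟩, ?_⟩
  · rw [hχ x hx, hχ' x hx, hc₁ x (subset_closure hx), hc₂ x (subset_closure hx)]
    ring
  · rintro ⟨x, hx⟩
    have hc0 : c₁ = 0 := by
      rcases hx with hx | hx
      · have hxc : x ∈ closure Ω :=
          frontier_subset_closure (hN₁.boundary_union ▸ Or.inr hx)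
        linarith [hc₁ x hxc, f₁.pressure_bc x hx, f₁'.pressure_bc x hx]
      · have hxc : x ∈ closure Ω :=
          frontier_subset_closure (hN₂.boundary_union ▸ Or.inr hx)
        linarith [hc₂ x hxc, f₂.pressure_bc x hx, f₂'.pressure_bc x hx]
    subst hc0
    exact ⟨fun x hx => by rw [hc₁ x hx, add_zero], fun x hx => by rw [hc₂ x hx, add_zero]⟩
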